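/- Let $p$ be a prime, let $\overline{\mathbb{Q}}_p$ be an algebraic closure of $\mathbb{Q}_p$ and $\mathbb{C}_p$ its completion, with absolute value $|\cdot|_p$. Let $\log_p:\mathbb{C}_p^*\to\mathbb{C}_p$ be the branch of the $p$-adic logarithm with $\log_p(p)=0$; it maps $\mathbb{Q}_p^*$ to $\mathbb{Q}_p$. Let $d\ge 0$ and $\Gamma=\mathbb{Z}^d$, and let $f=\sum_{\nu\in\Gamma}a_\nu t^\nu\in\mathbb{Z}[\Gamma]=\mathbb{Z}[t_1^{\pm1},\dots,t_d^{\pm1}]$ have no zero on the $p$-adic torus $T^d_p=\{z\in\mathbb{C}_p^d : |z_i|_p=1 \text{ for all } i\}$. Let $X_f\subset(\mathbb{R}/\mathbb{Z})^{\Gamma}$ be the closed subgroup of all $(x_{\gamma})$ with $\sum_{\gamma'\in\Gamma}a_{\gamma'-\gamma}\,x_{\gamma'}=0$ for all $\gamma\in\Gamma$, with the $\Gamma$-action $(\gamma x)_{\gamma'}=x_{\gamma'-\gamma}$. For a sequence $(\Gamma_n)$ of subgroups of finite index in $\Gamma$ write $\Gamma_n\to 0$ if $0$ is the only element of $\Gamma$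 that lies in infinitely many $\Gamma_n$, and let $\mathrm{Fix}_{\Gamma_n}(X_f)$ be the set of points of $X_f$ fixed by $\Gamma_n$. Then there is a number $h_p(f)\in\mathbb{Q}_p$ such that for every sequence $\Gamma_n\to 0$ all the sets $\mathrm{Fix}_{\Gamma_n}(X_f)$ are finite and $$\lim_{n\to\infty}\frac{1}{(\Gamma:\Gamma_n)}\log_p|\mathrm{Fix}_{\Gamma_n}(X_f)| = h_p(f)\quad\text{in }\mathbb{Q}_p,$$ that is, the $p$-adic entropy of the $\mathbb{Z}^d$-action on $X_f$ exists for all $\Gamma_n\to0$ and does not depend on the sequence. Moreover the Snirelman integral defining the $p$-adic Mahler measure of $f$, $$m_p(f)=\int_{T^d_p}\log_p f(z):=\lim_{N\to\infty,\ (N,p)=1}\frac{1}{N^d}\sum_{\zeta\in\mu_N^d}\log_p f(\zeta),$$ exists in $\mathbb{C}_p$, where $\mu_N$ is the group of $N$-th roots of unity in $\overline{\mathbb{Q}}_p^*$, and $h_p(f)=m_p(f)$. -/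

import Mathlib

open Filter Topology

noncomputable section

namespace PadicEntropy

/-- The logarithm series `log u = ∑_{k ≥ 1} (-1)^(k-1) (u - 1)^k / k`, which converges for
`‖u - 1‖ < 1` in a complete extension of `ℚ_[p]`. -/
def logSeries {K : Type*} [NormedField K] (u : K) : K :=
  ∑' k : ℕ, (-1) ^ k * (u - 1) ^ (k + 1) / ((k : K) + 1)

/-- The branch of the `p`-adic logarithm with `log_p p = 0`, on `K = ℚ_[p]` or `K = ℂ_[p]`.
For `x ≠ 0` in these fields there are `n ≥ 1` and `m ∈ ℤ` such that `u = x ^ n * p ^ (-m)`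
satisfies `‖u - 1‖ < 1`, and then `log_p x = (log u) / n`. This does not depend on `(n, m)`: for
another such pair `(n', m')` comparison of norms gives `m * n' = m' * n`, so `u ^ n' = u' ^ n`.
The value at `x = 0` is `0` and carries no meaning. -/
def padicLog (p : ℕ) {K : Type*} [NormedField K] (x : K) : K :=
  open Classical in
  if h : ∃ q : ℕ × ℤ, 0 < q.1 ∧ ‖x ^ q.1 * (p : K) ^ (-q.2) - 1‖ < 1 then
    logSeries (x ^ h.choose.1 * (p : K) ^ (-h.choose.2)) / (h.choose.1 : K)
  else 0

/-- `Γ_n → e` (for an additively written group): the `Γ_n` are normal subgroups of finite index,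
and only the neutral element lies in infinitely many of them. -/
structure TendsToTrivial {Γ : Type*} [AddGroup Γ] (Γs : ℕ → AddSubgroup Γ) : Prop where
  normal : ∀ n, (Γs n).Normal
  finiteIndex : ∀ n, (Γs n).FiniteIndex
  finite_mem : ∀ γ : Γ, γ ≠ 0 → {n | γ ∈ Γs n}.Finite

/-- The `p`-adic entropy of the action of `Γ` on the set `X` with respect to the sequence `Γ_n`
exists and equals `h`: all the sets `Fix_{Γ_n} X` are finite, and
`(Γ : Γ_n)⁻¹ * log_p |Fix_{Γ_n} X|` converges to `h` in `ℚ_[p]`. -/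
def HasPadicEntropy (p : ℕ) [Fact p.Prime] {Γ : Type*} [AddGroup Γ] (X : Type*) [AddAction Γ X]
    (Γs : ℕ → AddSubgroup Γ) (h : ℚ_[p]) : Prop :=
  (∀ n, (AddAction.fixedPoints (Γs n) X).Finite) ∧
  Tendsto (fun n => (((Γs n).index : ℕ) : ℚ_[p])⁻¹ *
      padicLog p ((Nat.card (AddAction.fixedPoints (Γs n) X) : ℕ) : ℚ_[p]))
    atTop (𝓝 h)

/-- For `f = ∑ a_γ γ` in the integral group ring of `Γ`, the closed subgroup `X_f` of the full
shift `(ℝ/ℤ)^Γ` of all `x` with `∑_{γ'} x_{γ'} a_{γ⁻¹γ'} = 0` for every `γ`. The sum is written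
over the support of `f`, with `γ' = γ δ`. -/
def subshift {Γ : Type*} [AddGroup Γ] (f : AddMonoidAlgebra ℤ Γ) :
    AddSubgroup (Γ → UnitAddCircle) where
  carrier := {x | ∀ γ : Γ, ∑ δ ∈ f.coeff.support, f.coeff δ • x (γ + δ) = 0}
  zero_mem' := by intro γ; simp
  add_mem' := by
    intro x y hx hy γ
    simp only [Pi.add_apply, smul_add, Finset.sum_add_distrib]
    rw [hx γ, hy γ, add_zero]
  neg_mem' := by
    intro x hx γ
    simp only [Pi.neg_apply, smul_neg, Finset.sum_neg_distrib]
    rw [hx γ, neg_zero]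

/-- The left shift action of `Γ` on `X_f`, `(γ x)_{γ'} = x_{γ⁻¹γ'}`. -/
instance subshiftAction {Γ : Type*} [AddGroup Γ] (f : AddMonoidAlgebra ℤ Γ) :
    AddAction Γ (subshift f) where
  vadd γ x := ⟨fun γ' => x.1 (-γ + γ'), fun γ' => by
    simpa only [add_assoc] using x.2 (-γ + γ')⟩
  zero_vadd x := Subtype.ext (funext fun γ' => by
    change x.1 (-0 + γ') = x.1 γ'
    rw [neg_zero, zero_add])
  add_vadd γ₁ γ₂ x := Subtype.ext (funext fun γ' => by
    change x.1 (-(γ₁ + γ₂) + γ') = x.1 (-γ₂ + (-γ₁ + γ'))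
    rw [neg_add_rev, add_assoc])

/-- The value at `z` of the Laurent polynomial `f = ∑_ν a_ν t^ν` in
`ℤ[t_1^{±1}, …, t_d^{±1}] = ℤ[ℤ^d]`. -/
def laurentEval {K : Type*} [Field K] {d : ℕ} (f : AddMonoidAlgebra ℤ (Fin d → ℤ))
    (z : Fin d → K) : K :=
  ∑ ν ∈ f.coeff.support, (f.coeff ν : K) * ∏ i, z i ^ ν i

/-- The `p`-adic `d`-torus `T^d_p`. -/
def padicTorus (p : ℕ) [Fact p.Prime] (d : ℕ) : Set (Fin d → ℂ_[p]) :=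
  {z | ∀ i, ‖z i‖ = 1}

/-- The Snirelman integral of `F` over `T^d_p` exists and equals `I`: the averages of `F` over
`μ_N^d` converge to `I` as `N → ∞` among the integers prime to `p`. -/
def HasSnirelmanIntegral (p : ℕ) [Fact p.Prime] {d : ℕ} (F : (Fin d → ℂ_[p]) → ℂ_[p])
    (I : ℂ_[p]) : Prop :=
  Tendsto (fun N : ℕ => ((N : ℂ_[p]) ^ d)⁻¹ *
      ∑ ζ ∈ Fintype.piFinset (fun _ : Fin d => Polynomial.nthRootsFinset N (1 : ℂ_[p])), F ζ)
    (atTop ⊓ 𝓟 {N : ℕ | N.Coprime p}) (𝓝 I)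

/-- The `p`-adic Mahler measure `m_p(f)`, i.e. the Snirelman integral of `log_p f` over `T^d_p`,
exists and equals `m`. -/
def HasPadicMahlerMeasure (p : ℕ) [Fact p.Prime] {d : ℕ} (f : AddMonoidAlgebra ℤ (Fin d → ℤ))
    (m : ℂ_[p]) : Prop :=
  HasSnirelmanIntegral p (fun z : Fin d → ℂ_[p] => padicLog p (laurentEval f z)) m

end PadicEntropy

end

/-! Both limits are, up to a fixed factor, the constant coefficient of a `p`-adic logarithm in the
group ring. After a power of `p` is removed from `f`, exactly one coefficient is prime to `p`: with
two of them, a specialisation to one variable would have two coefficients of maximal norm, hence a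
root of norm one (`eq_of_not_dvd_coeff`). So some `f ^ (2 * r)` is a power of `p` times the square
of a monomial times `u = 1 + p g`. Powers of `p` and monomials contribute nothing to either limit.
Writing `u ^ (p ^ n) = 1 + p ^ (n + 1) l_n` with integral `l_n`, the elements `p l_n` converge
`p`-adically to `log u`.

For `H` of finite index, `|Fix_H X_f|` is the absolute value of the determinant of `f` acting on
functions on `Γ ⧸ H`. Since log det = tr log and the trace is the index times the sum of the
coefficients over `H`, the normalised logarithm is `T H / (2 r)` with `T H = lim p * subgroupSum H
l_n` (`padicLog_card_fixedPoints`). Orthogonality of characters gives the average over `μ_N^d` the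
same form with `H = N ℤ^d` (`average_padicLog_laurentEval`). Convergence in `n` is uniform in `H`,
and a fixed `l_n` has finite support, so both quantities tend to `T ⊥ / (2 r)`
(`exists_tendsto_subgroupSum`). -/

noncomputable section

namespace PadicEntropy

/-! ### The `p`-adic logarithm as a limit of power quotients -/

section Log

variable {p : ℕ} [hp : Fact p.Prime] {K : Type*} [NormedField K] [NormedAlgebra ℚ_[p] K]

include hp in
lemma norm_natCast_eq (n : ℕ) : ‖(n : K)‖ = ‖(n : ℚ_[p])‖ := by
  rw [← map_natCast (algebraMap ℚ_[p] K) n, norm_algebraMap']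

variable (p K) in
include hp in
lemma charZero_of_normedAlgebra : CharZero K :=
  (RingHom.charZero_iff (algebraMap ℚ_[p] K).injective).mp inferInstance

variable (p) in
include hp in
lemma norm_natCast_le_one (n : ℕ) : ‖(n : K)‖ ≤ 1 := by
  rw [norm_natCast_eq (p := p)]
  exact_mod_cast Padic.norm_int_le_one (p := p) n

variable (p K) in
lemma norm_prime_cast_lt_one : ‖(p : K)‖ < 1 := by
  rw [norm_natCast_eq (p := p)]; exact Padic.norm_p_lt_one

variable (p) in
include hp in
lemma inv_norm_natCast_le {n : ℕ} (hn : n ≠ 0) : ‖(n : K)‖⁻¹ ≤ n := by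
  rw [norm_natCast_eq (p := p)]
  have h : ‖((n : ℤ) : ℚ_[p])‖ = (p : ℝ) ^ (-(padicValNat p n : ℤ)) := by
    rw [Int.cast_natCast, Padic.norm_eq_zpow_neg_valuation (by exact_mod_cast hn),
      Padic.valuation_natCast]
  rw [Int.cast_natCast] at h
  rw [h, zpow_neg, inv_inv, zpow_natCast]
  exact_mod_cast Nat.le_of_dvd (Nat.pos_of_ne_zero hn) pow_padicValNat_dvd

variable (p K) in
lemma tendsto_prime_pow_zero : Tendsto (fun n : ℕ => (p : K) ^ n) atTop (𝓝 0) :=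
  tendsto_pow_atTop_nhds_zero_of_norm_lt_one (norm_prime_cast_lt_one p K)

-- Pascal's rule: `C(p^n, k+1) = p^n / (k+1) * C(p^n - 1, k)` tends to `0`, so each step in `k`
-- flips the sign of the limit.
variable (p K) in
lemma tendsto_choose_prime_pow_sub_one (k : ℕ) :
    Tendsto (fun n : ℕ => ((p ^ n - 1).choose k : K)) atTop (𝓝 ((-1) ^ k)) := by
  have := charZero_of_normedAlgebra p K
  induction k with
  | zero => simp
  | succ k ih =>
    have h (n : ℕ) : ((p ^ n - 1).choose (k + 1) : K) =
        (p : K) ^ n * ((p ^ n - 1).choose k : K) / ((k : K) + 1) - ((p ^ n - 1).choose k : K) := by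
      obtain ⟨m, hm⟩ : ∃ m, p ^ n = m + 1 :=
        Nat.exists_eq_succ_of_ne_zero (pow_ne_zero n hp.out.ne_zero)
      have h1 := Nat.add_one_mul_choose_eq m k
      have h2 := Nat.choose_succ_succ m k
      have hk : (k : K) + 1 ≠ 0 := by exact_mod_cast k.succ_ne_zero
      have hpn : (p : K) ^ n = m + 1 := by exact_mod_cast hm
      rw [hpn, hm, Nat.add_sub_cancel, eq_sub_iff_add_eq, eq_div_iff hk]
      rw [h2] at h1
      have h3 := congrArg (Nat.cast (R := K)) h1
      push_cast at h3
      rw [h3]; ring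
    simp_rw [h]
    have := ((((tendsto_prime_pow_zero p K).mul ih).div_const ((k : K) + 1))).sub ih
    simpa [pow_succ] using this

/-- The `p`-adic logarithm is `log u = lim (u ^ (p ^ n) - 1) / p ^ n`. -/
lemma tendsto_logSeries [CompleteSpace K] {u : K} (hu : ‖u - 1‖ < 1) :
    Tendsto (fun n : ℕ => (u ^ p ^ n - 1) / (p : K) ^ n) atTop (𝓝 (logSeries u)) := by
  have := charZero_of_normedAlgebra p K
  -- Binomial expansion of `(1 + (u - 1)) ^ (p ^ n)`, written as an infinite series so that
  -- dominated convergence gives the termwise limit.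
  have hexp (n : ℕ) : (u ^ p ^ n - 1) / (p : K) ^ n =
      ∑' k : ℕ, ((p ^ n - 1).choose k : K) * (u - 1) ^ (k + 1) / ((k : K) + 1) := by
    obtain ⟨m, hm⟩ : ∃ m, p ^ n = m + 1 :=
      Nat.exists_eq_succ_of_ne_zero (pow_ne_zero n hp.out.ne_zero)
    have hpn : (p : K) ^ n = m + 1 := by exact_mod_cast hm
    have hm0 : (m : K) + 1 ≠ 0 := by exact_mod_cast m.succ_ne_zero
    rw [hpn, hm, Nat.add_sub_cancel, tsum_eq_sum (s := Finset.range (m + 1))]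
    · have h1 : u ^ (m + 1) = ((u - 1) + 1) ^ (m + 1) := by ring
      rw [h1, add_pow, Finset.sum_range_succ']
      simp only [one_pow, mul_one, pow_zero, Nat.choose_zero_right, Nat.cast_one,
        add_sub_cancel_right]
      rw [Finset.sum_div]
      refine Finset.sum_congr rfl fun k _ => ?_
      have hk : (k : K) + 1 ≠ 0 := by exact_mod_cast k.succ_ne_zero
      have h3 := congrArg (Nat.cast (R := K)) (Nat.add_one_mul_choose_eq m k)
      push_cast at h3
      rw [div_eq_div_iff hm0 hk]
      linear_combination (-(u - 1) ^ (k + 1)) * h3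
    · intro k hk
      rw [Finset.mem_range, not_lt] at hk
      rw [Nat.choose_eq_zero_of_lt (by omega)]; simp
  simp_rw [hexp]
  refine tendsto_tsum_of_dominated_convergence
    (bound := fun k : ℕ => ((k + 1 : ℕ) : ℝ) * ‖u - 1‖ ^ (k + 1)) ?_ ?_ ?_
  · have := summable_pow_mul_geometric_of_norm_lt_one 1 (r := ‖u - 1‖) (by simpa using hu)
    simpa using (summable_nat_add_iff 1).2 this
  · intro k
    exact ((tendsto_choose_prime_pow_sub_one p K k).mul_const _).div_const _
  · refine Eventually.of_forall fun n k => ?_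
    rw [norm_div, norm_mul, norm_pow, div_eq_mul_inv, mul_comm]
    have h1 := inv_norm_natCast_le p (K := K) k.succ_ne_zero
    push_cast at h1 ⊢
    refine mul_le_mul h1 ?_ (by positivity) (by positivity)
    exact mul_le_of_le_one_left (by positivity) (norm_natCast_le_one p _)

variable (p) in
include hp in
lemma norm_mul_sub_one_lt {u v : K} (hu : ‖u - 1‖ < 1) (hv : ‖v - 1‖ < 1) :
    ‖u * v - 1‖ < 1 := by
  have : IsUltrametricDist K := IsUltrametricDist.of_normedAlgebra ℚ_[p]
  have h : u * v - 1 = ((u - 1) * (v - 1) + (u - 1)) + (v - 1) := by ring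
  rw [h]
  refine (IsUltrametricDist.norm_add_le_max _ _).trans_lt (max_lt ?_ hv)
  refine (IsUltrametricDist.norm_add_le_max _ _).trans_lt (max_lt ?_ hu)
  rw [norm_mul]
  exact mul_lt_one_of_nonneg_of_lt_one_left (norm_nonneg _) hu hv.le

variable (p) in
include hp in
lemma norm_pow_sub_one_lt {u : K} (hu : ‖u - 1‖ < 1) (n : ℕ) : ‖u ^ n - 1‖ < 1 := by
  induction n with
  | zero => simp
  | succ n ih => rw [pow_succ]; exact norm_mul_sub_one_lt p ih hu

-- With `q = p ^ n`, the cross term in `(uv)^q - 1 = (u^q - 1)(v^q - 1) + (u^q - 1) + (v^q - 1)` is,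
-- after division by `q`, `q` times a convergent product.
variable (p) in
include hp in
lemma logSeries_mul [CompleteSpace K] {u v : K} (hu : ‖u - 1‖ < 1) (hv : ‖v - 1‖ < 1) :
    logSeries (u * v) = logSeries u + logSeries v := by
  have := charZero_of_normedAlgebra p K
  have h1 := tendsto_logSeries (p := p) hu
  have h2 := tendsto_logSeries (p := p) hv
  have h3 := tendsto_logSeries (p := p) (norm_mul_sub_one_lt p hu hv)
  refine tendsto_nhds_unique h3 ?_
  have h4 := ((h1.mul h2).mul (tendsto_prime_pow_zero p K)).add (h1.add h2)
  rw [mul_zero, zero_add] at h4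
  refine h4.congr fun n => ?_
  have hpn : (p : K) ^ n ≠ 0 := pow_ne_zero _ (by exact_mod_cast hp.out.ne_zero)
  field_simp
  ring

variable (p) in
include hp in
lemma logSeries_pow [CompleteSpace K] {u : K} (hu : ‖u - 1‖ < 1) (n : ℕ) :
    logSeries (u ^ n) = n * logSeries u := by
  induction n with
  | zero => simp [logSeries]
  | succ n ih =>
    rw [pow_succ, logSeries_mul p (norm_pow_sub_one_lt p hu n) hu, ih]; push_cast; ring

variable (p) in
include hp in
lemma norm_eq_one_of_norm_sub_one_lt {u : K} (hu : ‖u - 1‖ < 1) : ‖u‖ = 1 := by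
  have : IsUltrametricDist K := IsUltrametricDist.of_normedAlgebra ℚ_[p]
  have := IsUltrametricDist.norm_add_eq_max_of_norm_ne_norm (x := u - 1) (y := 1)
    (by rw [norm_one]; exact hu.ne)
  rw [sub_add_cancel, norm_one, max_eq_right hu.le] at this
  exact this

lemma padicLog_eq [CompleteSpace K] {x : K} {q : ℕ} {m : ℤ} (hq : 0 < q)
    (h : ‖x ^ q * (p : K) ^ (-m) - 1‖ < 1) :
    padicLog p x = logSeries (x ^ q * (p : K) ^ (-m)) / (q : K) := by
  have := charZero_of_normedAlgebra p K
  have hex : ∃ q : ℕ × ℤ, 0 < q.1 ∧ ‖x ^ q.1 * (p : K) ^ (-q.2) - 1‖ < 1 := ⟨(q, m), hq, h⟩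
  rw [padicLog, dif_pos hex]
  obtain ⟨hr, h'⟩ := hex.choose_spec
  set r := hex.choose.1
  set l := hex.choose.2
  have hp0 : (p : K) ≠ 0 := by exact_mod_cast hp.out.ne_zero
  have hpn : 0 < ‖(p : K)‖ := norm_pos_iff.2 hp0
  have e1 := norm_eq_one_of_norm_sub_one_lt p h
  have e2 := norm_eq_one_of_norm_sub_one_lt p h'
  rw [norm_mul, norm_pow, norm_zpow, zpow_neg, mul_inv_eq_one₀ (by positivity)] at e1 e2
  have e3 : ‖(p : K)‖ ^ (m * r) = ‖(p : K)‖ ^ (l * q) := by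
    rw [zpow_mul, zpow_mul, ← e1, ← e2, zpow_natCast, zpow_natCast, ← pow_mul, ← pow_mul, mul_comm]
  have e4 : m * r = l * q := zpow_right_injective₀ hpn (norm_prime_cast_lt_one p K).ne e3
  have e5 : (x ^ q * (p : K) ^ (-m)) ^ r = (x ^ r * (p : K) ^ (-l)) ^ q := by
    rw [mul_pow, mul_pow, ← pow_mul, ← pow_mul, ← zpow_natCast ((p : K) ^ (-m)),
      ← zpow_natCast ((p : K) ^ (-l)), ← zpow_mul, ← zpow_mul, neg_mul, neg_mul, e4, mul_comm r]
  have e6 := congrArg logSeries e5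
  rw [logSeries_pow p h, logSeries_pow p h'] at e6
  have hq0 : (q : K) ≠ 0 := by exact_mod_cast hq.ne'
  have hr0 : (r : K) ≠ 0 := by exact_mod_cast hr.ne'
  rw [div_eq_div_iff hr0 hq0]
  linear_combination -e6

/-- If `u ^ (p ^ n) = 1 + p ^ (n + 1) * l n` for all `n`, then `log u = lim p * l n`. -/
lemma tendsto_logSeries_of_pow_eq [CompleteSpace K] {u : K} (hu : ‖u - 1‖ < 1) {l : ℕ → K}
    (h : ∀ n, u ^ p ^ n = 1 + (p : K) ^ (n + 1) * l n) :
    Tendsto (fun n => (p : K) * l n) atTop (𝓝 (logSeries u)) := by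
  have := charZero_of_normedAlgebra p K
  refine (tendsto_logSeries (p := p) hu).congr fun n => ?_
  have hpn : (p : K) ^ n ≠ 0 := pow_ne_zero _ (by exact_mod_cast hp.out.ne_zero)
  rw [h, add_sub_cancel_left, pow_succ]
  field_simp

end Log

/-- In the `p`-th power of `1 + p^(n+1) a` the terms beyond the linear one are divisible by
`p^(2n+2) = p^(n+2) * p^n`. The sequence `l` is thus `p`-adically Cauchy without leaving `R`. -/
lemma exists_pow_prime_pow_eq {R : Type*} [CommRing R] (p : ℕ) (g : R) :
    ∃ l : ℕ → R, ∀ n, (1 + (p : R) * g) ^ p ^ n = 1 + (p : R) ^ (n + 1) * l n ∧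
      (p : R) ^ n ∣ l (n + 1) - l n := by
  have step (n : ℕ) (a : R) : ∃ b : R,
      (1 + (p : R) ^ (n + 1) * a) ^ p = 1 + (p : R) ^ (n + 2) * (a + (p : R) ^ n * b) := by
    obtain ⟨k, hk⟩ := Polynomial.powAddExpansion 1 ((p : R) ^ (n + 1) * a) p
    refine ⟨k * a ^ 2, ?_⟩
    rw [hk, one_pow, one_pow]; ring
  choose b hb using step
  let l : ℕ → R := fun n => Nat.rec g (fun n a => a + (p : R) ^ n * b n a) n
  refine ⟨l, fun n => ⟨?_, ⟨b n (l n), by simp [l]⟩⟩⟩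
  induction n with
  | zero => simp [l]
  | succ n ih => rw [pow_succ p n, pow_mul, ih, hb]

/-! ### Finite quotients: coefficient sums, traces and determinants -/

section GroupRing

variable {Γ : Type*} [AddCommGroup Γ] (H : AddSubgroup Γ)

open Classical in
/-- The sum of the coefficients of an element of `ℤ[Γ]` over the elements of a subgroup. -/
def subgroupSum : AddMonoidAlgebra ℤ Γ →+ ℤ :=
  (Finsupp.liftAddHom fun δ => if δ ∈ H then AddMonoidHom.id ℤ else 0).comp
    AddMonoidAlgebra.coeffAddEquiv.toAddMonoidHom

open Classical in
lemma subgroupSum_apply (a : AddMonoidAlgebra ℤ Γ) :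
    subgroupSum H a = ∑ δ ∈ a.coeff.support, if δ ∈ H then a.coeff δ else 0 := by
  simp only [subgroupSum, AddMonoidHom.comp_apply, Finsupp.liftAddHom_apply, Finsupp.sum]
  refine Finset.sum_congr rfl fun δ _ => ?_
  split_ifs <;> rfl

open Classical in
lemma subgroupSum_single (γ : Γ) (r : ℤ) :
    subgroupSum H (AddMonoidAlgebra.single γ r) = if γ ∈ H then r else 0 := by
  simp only [subgroupSum, AddMonoidHom.comp_apply]
  refine (Finsupp.liftAddHom_apply_single _ _ _).trans ?_
  split_ifs <;> rfl

lemma natCast_dvd_subgroupSum {n : ℕ} {a : AddMonoidAlgebra ℤ Γ}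
    (h : (n : AddMonoidAlgebra ℤ Γ) ∣ a) : (n : ℤ) ∣ subgroupSum H a := by
  obtain ⟨b, rfl⟩ := h
  rw [← nsmul_eq_mul, map_nsmul, nsmul_eq_mul]
  exact dvd_mul_right _ _

lemma eventually_subgroupSum_eq {ι : Type*} {F : Filter ι} {Hs : ι → AddSubgroup Γ}
    (hH : ∀ γ : Γ, γ ≠ 0 → ∀ᶠ i in F, γ ∉ Hs i) (a : AddMonoidAlgebra ℤ Γ) :
    ∀ᶠ i in F, subgroupSum (Hs i) a = subgroupSum ⊥ a := by
  have h : ∀ᶠ i in F, ∀ γ ∈ a.coeff.support, γ ≠ 0 → γ ∉ Hs i := by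
    rw [eventually_all_finset]
    intro γ _
    by_cases h0 : γ = 0
    · simp [h0]
    · filter_upwards [hH γ h0] with i hi _ using hi
  filter_upwards [h] with i hi
  rw [subgroupSum_apply, subgroupSum_apply]
  refine Finset.sum_congr rfl fun γ hγ => ?_
  by_cases h0 : γ = 0
  · simp [h0]
  · simp [h0, hi γ hγ h0]

variable [Fintype (Γ ⧸ H)] [DecidableEq (Γ ⧸ H)]

/-- The action of `ℤ[Γ]` on functions on `Γ ⧸ H`, as matrices. -/
def quotientRep : AddMonoidAlgebra ℤ Γ →ₐ[ℤ] Matrix (Γ ⧸ H) (Γ ⧸ H) ℤ :=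
  AddMonoidAlgebra.lift ℤ (Matrix (Γ ⧸ H) (Γ ⧸ H) ℤ) Γ
    { toFun := fun γ => Matrix.of fun a b => if b = a + (γ.toAdd : Γ) then 1 else 0
      map_one' := by
        ext a b
        simp [Matrix.one_apply, eq_comm]
      map_mul' := fun γ δ => by
        ext a b
        rw [Matrix.mul_apply, Finset.sum_eq_single (a + (γ.toAdd : Γ))]
        · simp [add_assoc]
          rfl
        · intro c _ hc
          simp [hc]
        · simp }

lemma quotientRep_single (γ : Γ) (r : ℤ) (a b : Γ ⧸ H) :
    quotientRep H (AddMonoidAlgebra.single γ r) a b = if b = a + (γ : Γ) then r else 0 := by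
  simp [quotientRep]

lemma quotientRep_apply (f : AddMonoidAlgebra ℤ Γ) (a b : Γ ⧸ H) :
    quotientRep H f a b = ∑ δ ∈ f.coeff.support, if b = a + (δ : Γ) then f.coeff δ else 0 := by
  rw [quotientRep, AddMonoidAlgebra.lift_apply, Finsupp.sum, Matrix.sum_apply]
  simp

/-- Translation by `γ` on `Γ ⧸ H` fixes every point if `γ ∈ H` and none otherwise. -/
lemma trace_quotientRep (f : AddMonoidAlgebra ℤ Γ) :
    (quotientRep H f).trace = H.index * subgroupSum H f := by
  classical
  have : (Matrix.traceAddMonoidHom (Γ ⧸ H) ℤ).comp (quotientRep H).toRingHom.toAddMonoidHom =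
      (AddMonoidHom.mulLeft (H.index : ℤ)).comp (subgroupSum H) := by
    refine AddMonoidAlgebra.addMonoidHom_ext fun γ r => ?_
    have h (a : Γ ⧸ H) : (a = a + (γ : Γ)) ↔ γ ∈ H := by
      rw [left_eq_add, QuotientAddGroup.eq_zero_iff]
    simp [Matrix.trace, quotientRep_single, subgroupSum_single, h, AddSubgroup.index,
      Nat.card_eq_fintype_card]
  exact DFunLike.congr_fun this f

/-- A permutation matrix has determinant `±1`; the square removes the sign. -/
lemma det_quotientRep_single_sq (γ : Γ) :
    (quotientRep H (AddMonoidAlgebra.single γ 1)).det ^ 2 = 1 := by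
  have h : (quotientRep H (AddMonoidAlgebra.single γ 1)).det *
      (quotientRep H (AddMonoidAlgebra.single (-γ) 1)).det = 1 := by
    rw [← Matrix.det_mul, ← map_mul, AddMonoidAlgebra.single_mul_single, add_neg_cancel, one_mul,
      ← AddMonoidAlgebra.one_def, map_one, Matrix.det_one]
  rcases Int.isUnit_iff.1 (IsUnit.of_mul_eq_one _ h) with h | h <;> simp [h]

lemma exists_det_quotientRep_eq (n : ℕ) (a : AddMonoidAlgebra ℤ Γ) :
    ∃ e : ℤ, (quotientRep H (1 + (n : AddMonoidAlgebra ℤ Γ) * a)).det =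
      1 + n * (H.index * subgroupSum H a + n * e) := by
  have h := Matrix.det_one_add_smul (n : ℤ) (quotientRep H a)
  rw [trace_quotientRep] at h
  rw [map_add, map_one, map_mul, map_natCast, ← nsmul_eq_mul, ← natCast_zsmul, h]
  generalize Polynomial.eval (n : ℤ) _ = e
  exact ⟨e, by ring⟩

section Limits

variable {p : ℕ} [hp : Fact p.Prime]

/-- This is log det = tr log: `det(1 + p^(n+1) l_n)` is `1 + p^(n+1) tr(l_n)` up to a multiple of
`p^(2n+2)`, an error that vanishes in the limit. -/
lemma tendsto_logSeries_det {u : AddMonoidAlgebra ℤ Γ} {l : ℕ → AddMonoidAlgebra ℤ Γ}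
    (h : ∀ n, u ^ p ^ n = 1 + (p : AddMonoidAlgebra ℤ Γ) ^ (n + 1) * l n) :
    ‖((quotientRep H u).det : ℚ_[p]) - 1‖ < 1 ∧
    Tendsto (fun n => (H.index : ℚ_[p]) * ((p : ℚ_[p]) * (subgroupSum H (l n) : ℚ_[p]))) atTop
      (𝓝 (logSeries ((quotientRep H u).det : ℚ_[p]))) := by
  have h1 (n : ℕ) : ∃ e : ℤ, (quotientRep H u).det ^ p ^ n =
      1 + (p : ℤ) ^ (n + 1) * (H.index * subgroupSum H (l n) + (p : ℤ) ^ (n + 1) * e) := by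
    obtain ⟨e, he⟩ := exists_det_quotientRep_eq H (p ^ (n + 1)) (l n)
    refine ⟨e, ?_⟩
    push_cast at he
    rw [← Matrix.det_pow, ← map_pow, h, he]
  choose e he using h1
  have h0 : ‖((quotientRep H u).det : ℚ_[p]) - 1‖ < 1 := by
    have := he 0
    rw [pow_zero, pow_one, zero_add, pow_one] at this
    rw [this]
    push_cast
    rw [add_sub_cancel_left, norm_mul]
    refine mul_lt_one_of_nonneg_of_lt_one_left (norm_nonneg _) Padic.norm_p_lt_one ?_
    exact_mod_cast Padic.norm_int_le_one (p := p) (H.index * subgroupSum H (l 0) + p * e 0)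
  refine ⟨h0, ?_⟩
  have h2 := tendsto_logSeries_of_pow_eq (p := p) h0
    (l := fun n => (H.index * subgroupSum H (l n) + (p : ℚ_[p]) ^ (n + 1) * e n)) (fun n => by
      exact_mod_cast congrArg (Int.cast (R := ℚ_[p])) (he n))
  have h3 : Tendsto (fun n => (p : ℚ_[p]) ^ (n + 1 + 1) * e n) atTop (𝓝 0) := by
    have h4 := (tendsto_pow_atTop_nhds_zero_of_lt_one (norm_nonneg (p : ℚ_[p]))
      Padic.norm_p_lt_one).comp (tendsto_add_atTop_nat 2)
    refine squeeze_zero_norm (fun n => ?_) h4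
    rw [norm_mul, norm_pow]
    exact mul_le_of_le_one_right (by positivity) (Padic.norm_int_le_one _)
  have h4 := h2.sub h3
  rw [sub_zero] at h4
  refine h4.congr fun n => ?_
  ring

end Limits

end GroupRing

/-- Subgroup sums along a `p`-adic Cauchy sequence in `ℤ[Γ]` converge `p`-adically, uniformly in
the subgroup. -/
lemma exists_tendsto_subgroupSum {p : ℕ} [hp : Fact p.Prime] {Γ : Type*} [AddCommGroup Γ]
    {l : ℕ → AddMonoidAlgebra ℤ Γ}
    (h : ∀ n, (p : AddMonoidAlgebra ℤ Γ) ^ n ∣ l (n + 1) - l n) :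
    ∃ T : AddSubgroup Γ → ℚ_[p],
      (∀ H, Tendsto (fun n => (p : ℚ_[p]) * (subgroupSum H (l n) : ℚ_[p])) atTop (𝓝 (T H))) ∧
      ∀ {F : Filter ℕ} {Hs : ℕ → AddSubgroup Γ}, (∀ γ : Γ, γ ≠ 0 → ∀ᶠ i in F, γ ∉ Hs i) →
        Tendsto (fun i => T (Hs i)) F (𝓝 (T ⊥)) := by
  have hd (H : AddSubgroup Γ) (n : ℕ) :
      dist ((p : ℚ_[p]) * (subgroupSum H (l n) : ℚ_[p]))
        ((p : ℚ_[p]) * (subgroupSum H (l (n + 1)) : ℚ_[p])) ≤ 1 * ‖(p : ℚ_[p])‖ ^ n := by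
    have h1 : ((p ^ n : ℕ) : AddMonoidAlgebra ℤ Γ) ∣ l (n + 1) - l n := by exact_mod_cast h n
    obtain ⟨e, he⟩ := natCast_dvd_subgroupSum H h1
    rw [map_sub] at he
    rw [dist_comm, dist_eq_norm, ← mul_sub, ← Int.cast_sub, he]
    push_cast
    rw [norm_mul, norm_mul, norm_pow]
    exact mul_le_mul Padic.norm_p_lt_one.le
      (mul_le_of_le_one_right (by positivity) (Padic.norm_int_le_one _)) (by positivity) zero_le_one
  have hT (H : AddSubgroup Γ) := cauchySeq_tendsto_of_complete
    (cauchySeq_of_le_geometric _ _ Padic.norm_p_lt_one (hd H))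
  choose T hT using hT
  refine ⟨T, hT, fun {F Hs} hH => ?_⟩
  have hb (H : AddSubgroup Γ) (n : ℕ) := dist_le_of_le_geometric_of_tendsto _ _
    Padic.norm_p_lt_one (hd H) (hT H) n
  have hz : Tendsto (fun n => 1 * ‖(p : ℚ_[p])‖ ^ n / (1 - ‖(p : ℚ_[p])‖)) atTop (𝓝 0) := by
    simpa using ((tendsto_pow_atTop_nhds_zero_of_lt_one (norm_nonneg (p : ℚ_[p]))
      Padic.norm_p_lt_one).div_const (1 - ‖(p : ℚ_[p])‖))
  -- One `n` brings `T H` within `ε / 2` of its approximation for all `H` at once; for this `n` the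
  -- approximations at `Hs i` and `⊥` eventually coincide.
  rw [Metric.tendsto_nhds]
  intro ε hε
  obtain ⟨n, hn⟩ := (hz.eventually (gt_mem_nhds (half_pos hε))).exists
  filter_upwards [eventually_subgroupSum_eq hH (l n)] with i hi
  have h1 := hb (Hs i) n
  have h2 := hb ⊥ n
  rw [hi, dist_comm] at h1
  linarith [dist_triangle (T (Hs i)) ((p : ℚ_[p]) * (subgroupSum ⊥ (l n) : ℚ_[p])) (T ⊥)]

/-! ### Kernels of integral matrices on a torus -/

section Kernel

variable {ι : Type*} [Fintype ι] [DecidableEq ι]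

lemma card_quotient_range_mulVec {A : Matrix ι ι ℤ} (hA : A.det ≠ 0) :
    (LinearMap.range A.mulVecLin).toAddSubgroup.index = A.det.natAbs := by
  have hinj : Function.Injective A.mulVecLin :=
    (injective_iff_map_eq_zero _).2 fun v hv => Matrix.eq_zero_of_mulVec_eq_zero hA hv
  have := Submodule.natAbs_det_equiv (LinearMap.range A.mulVecLin)
    (LinearEquiv.ofInjective A.mulVecLin hinj)
  rw [← LinearMap.det_toLin', Matrix.toLin'_apply', AddSubgroup.index]
  exact this.symm

/-- The endomorphism of a torus given by an integral matrix `A` with `det A ≠ 0` has a kernel with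
`|det A|` elements. -/
lemma card_torus_kernel {A : Matrix ι ι ℤ} (hA : A.det ≠ 0) :
    {y : ι → UnitAddCircle | ∀ i, ∑ j, A i j • y j = 0}.Finite ∧
    Nat.card {y : ι → UnitAddCircle | ∀ i, ∑ j, A i j • y j = 0} = A.det.natAbs := by
  let B : Matrix ι ι ℝ := A.map (Int.cast : ℤ → ℝ)
  have hB : IsUnit B.det := by
    have : B.det = (A.det : ℝ) := ((Int.castRingHom ℝ).map_det A).symm
    rw [this, isUnit_iff_ne_zero]; exact_mod_cast hA
  -- The map `v ↦ A⁻¹ v` modulo integers has kernel `A ℤ^ι` and its range is the torus kernel, which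
  -- therefore has order `[ℤ^ι : A ℤ^ι] = |det A|`.
  let φ : (ι → ℤ) →+ (ι → UnitAddCircle) := AddMonoidHom.mk'
    (fun v i => ((B⁻¹.mulVec (fun j => (v j : ℝ)) i : ℝ) : UnitAddCircle)) (fun v w => by
      funext i
      have : (fun j => (((v + w) j : ℤ) : ℝ)) = (fun j => (v j : ℝ)) + fun j => (w j : ℝ) := by
        ext j; simp
      rw [this, Matrix.mulVec_add]
      rfl)
  have hint (x : ℝ) : ((x : ℝ) : UnitAddCircle) = 0 ↔ ∃ n : ℤ, (n : ℝ) = x := by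
    rw [AddCircle.coe_eq_zero_iff]; simp
  have hBA (v : ι → ℤ) : B.mulVec (fun j => (v j : ℝ)) = fun i => ((A.mulVec v i : ℤ) : ℝ) := by
    ext i; simp [Matrix.mulVec, dotProduct, B]
  have hker : φ.ker = (LinearMap.range A.mulVecLin).toAddSubgroup := by
    ext v
    rw [AddMonoidHom.mem_ker]
    constructor
    · intro hv
      have h1 (i : ι) : ∃ n : ℤ, (n : ℝ) = B⁻¹.mulVec (fun j => (v j : ℝ)) i :=
        (hint _).1 (congrFun hv i)
      choose w hw using h1
      refine ⟨w, ?_⟩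
      have h2 : B.mulVec (fun j => (w j : ℝ)) = fun j => (v j : ℝ) := by
        rw [show (fun j => (w j : ℝ)) = B⁻¹.mulVec (fun j => (v j : ℝ)) from funext hw,
          Matrix.mulVec_mulVec, Matrix.mul_nonsing_inv _ hB, Matrix.one_mulVec]
      rw [hBA] at h2
      ext i
      exact_mod_cast congrFun h2 i
    · rintro ⟨w, rfl⟩
      ext i
      refine (hint _).2 ⟨w i, ?_⟩
      rw [Matrix.mulVecLin_apply, ← hBA, Matrix.mulVec_mulVec, Matrix.nonsing_inv_mul _ hB,
        Matrix.one_mulVec]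
  have hcoe (x : ι → ℝ) (i : ι) :
      ∑ j, A i j • ((x j : ℝ) : UnitAddCircle) = ((B.mulVec x i : ℝ) : UnitAddCircle) := by
    have : B.mulVec x i = ∑ j, A i j • x j := by simp [Matrix.mulVec, dotProduct, B]
    rw [this]
    symm
    exact (map_sum (QuotientAddGroup.mk' _) _ _)
  have hrange : {y : ι → UnitAddCircle | ∀ i, ∑ j, A i j • y j = 0} = φ.range := by
    ext y
    constructor
    · intro hy
      obtain ⟨x, rfl⟩ : ∃ x : ι → ℝ, (fun j => ((x j : ℝ) : UnitAddCircle)) = y :=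
        ⟨fun j => (QuotientAddGroup.mk_surjective (y j)).choose,
          funext fun j => (QuotientAddGroup.mk_surjective (y j)).choose_spec⟩
      have h1 (i : ι) : ∃ n : ℤ, (n : ℝ) = B.mulVec x i := (hint _).1 ((hcoe x i).symm.trans (hy i))
      choose v hv using h1
      refine ⟨v, ?_⟩
      ext i
      change ((B⁻¹.mulVec (fun j => (v j : ℝ)) i : ℝ) : UnitAddCircle) = _
      rw [show (fun j => (v j : ℝ)) = B.mulVec x from funext hv, Matrix.mulVec_mulVec,
        Matrix.nonsing_inv_mul _ hB, Matrix.one_mulVec]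
    · rintro ⟨v, rfl⟩ i
      refine (hcoe _ i).trans ((hint _).2 ⟨v i, ?_⟩)
      rw [Matrix.mulVec_mulVec, Matrix.mul_nonsing_inv _ hB, Matrix.one_mulVec]
  have hcard : Nat.card φ.range = A.det.natAbs := by
    rw [← AddSubgroup.index_ker, hker, card_quotient_range_mulVec hA]
  rw [hrange]
  refine ⟨Nat.finite_of_card_ne_zero ?_, hcard⟩
  exact hcard.trans_ne (by simpa using hA)

end Kernel

/-! ### Counting fixed points of the subshift -/

section FixedPoints

variable {Γ : Type*} [AddCommGroup Γ] (H : AddSubgroup Γ) [Fintype (Γ ⧸ H)] [DecidableEq (Γ ⧸ H)]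

lemma sum_quotientRep_smul (f : AddMonoidAlgebra ℤ Γ) (y : Γ ⧸ H → UnitAddCircle) (γ : Γ ⧸ H) :
    ∑ b, quotientRep H f γ b • y b = ∑ δ ∈ f.coeff.support, f.coeff δ • y (γ + (δ : Γ)) := by
  simp_rw [quotientRep_apply, Finset.sum_smul, ite_smul, zero_smul]
  rw [Finset.sum_comm]
  simp

/-- The points of `X_f` fixed by `H` are the functions on `Γ ⧸ H` annihilated by `f`. -/
def fixedPointsEquiv (f : AddMonoidAlgebra ℤ Γ) :
    AddAction.fixedPoints H (subshift f) ≃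
      {y : Γ ⧸ H → UnitAddCircle | ∀ a, ∑ b, quotientRep H f a b • y b = 0} where
  toFun x := ⟨fun a => Quotient.liftOn' a x.1.1 (fun a b hab => by
      rw [QuotientAddGroup.leftRel_apply] at hab
      have h := congrFun (congrArg Subtype.val (x.2 ⟨-a + b, hab⟩)) b
      change x.1.1 (-(-a + b) + b) = x.1.1 b at h
      rwa [neg_add_rev, neg_neg, neg_add_cancel_comm] at h), fun a => by
    induction a using QuotientAddGroup.induction_on with
    | H a =>
      rw [sum_quotientRep_smul]
      exact x.1.2 a⟩
  invFun y := ⟨⟨fun γ => y.1 (γ : Γ ⧸ H), fun γ => by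
      have h := y.2 (γ : Γ ⧸ H)
      rw [sum_quotientRep_smul] at h
      exact h⟩, fun h => Subtype.ext (funext fun γ => by
        change y.1 ((-(h : Γ) + γ : Γ) : Γ ⧸ H) = y.1 (γ : Γ ⧸ H)
        refine congrArg y.1 (QuotientAddGroup.eq.2 ?_)
        rw [neg_add_rev, neg_neg, neg_add_cancel_comm]
        exact h.2)⟩
  left_inv x := rfl
  right_inv y := Subtype.ext (funext fun a => by
    induction a using QuotientAddGroup.induction_on with
    | H a => rfl)

lemma finite_card_fixedPoints {f : AddMonoidAlgebra ℤ Γ} (hf : (quotientRep H f).det ≠ 0) :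
    (AddAction.fixedPoints H (subshift f)).Finite ∧
      Nat.card (AddAction.fixedPoints H (subshift f)) = (quotientRep H f).det.natAbs := by
  obtain ⟨h1, h2⟩ := card_torus_kernel hf
  have := h1.to_subtype
  refine ⟨?_, (Nat.card_congr (fixedPointsEquiv H f)).trans h2⟩
  have := Finite.of_equiv _ (fixedPointsEquiv H f).symm
  exact Set.toFinite _

end FixedPoints

/-! ### Roots of norm one and dominant coefficients -/

section Dominant

open Polynomial

variable {K : Type*} [NormedField K] [IsUltrametricDist K]

/-- By the ultrametric inequality the dominant index moves up by one if `‖r‖ < 1` and stays put if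
`‖r‖ > 1`. -/
lemma exists_dominant_coeff_mul_X_sub_C {P : K[X]} {r : K} (hr : ‖r‖ ≠ 1)
    (h : ∃ j, ∀ i, i ≠ j → ‖P.coeff i‖ < ‖P.coeff j‖) :
    ∃ j, ∀ i, i ≠ j → ‖(P * (X - C r)).coeff i‖ < ‖(P * (X - C r)).coeff j‖ := by
  obtain ⟨j, hj⟩ := h
  have hpos : 0 < ‖P.coeff j‖ := (norm_nonneg _).trans_lt (hj (j + 1) (by simp))
  have hle (i : ℕ) : ‖P.coeff i‖ ≤ ‖P.coeff j‖ := by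
    by_cases h : i = j
    · rw [h]
    · exact (hj i h).le
  have hsucc (i : ℕ) : (P * (X - C r)).coeff (i + 1) = P.coeff i + -(P.coeff (i + 1) * r) := by
    rw [mul_sub, coeff_sub, coeff_mul_X, coeff_mul_C, sub_eq_add_neg]
  have hzero : (P * (X - C r)).coeff 0 = -(P.coeff 0 * r) := by
    rw [mul_sub, coeff_sub, coeff_mul_X_zero, coeff_mul_C, zero_sub]
  rcases lt_or_gt_of_ne hr with hr | hr
  · have hsmall (i : ℕ) : ‖-(P.coeff i * r)‖ < ‖P.coeff j‖ := by
      rw [norm_neg, norm_mul]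
      calc ‖P.coeff i‖ * ‖r‖ ≤ ‖P.coeff j‖ * ‖r‖ := by gcongr; exact hle i
        _ < ‖P.coeff j‖ := mul_lt_of_lt_one_right hpos hr
    have htop : ‖(P * (X - C r)).coeff (j + 1)‖ = ‖P.coeff j‖ := by
      rw [hsucc, IsUltrametricDist.norm_add_eq_max_of_norm_ne_norm (hsmall _).ne',
        max_eq_left (hsmall _).le]
    refine ⟨j + 1, fun i hi => ?_⟩
    rw [htop]
    cases i with
    | zero => rw [hzero]; exact hsmall 0
    | succ i =>
      rw [hsucc]
      exact (IsUltrametricDist.norm_add_le_max _ _).trans_lt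
        (max_lt (hj i (by simpa using hi)) (hsmall _))
  · have hbig (i : ℕ) (hi : i ≠ j) : ‖-(P.coeff i * r)‖ < ‖P.coeff j * r‖ := by
      rw [norm_neg, norm_mul, norm_mul]
      exact mul_lt_mul_of_pos_right (hj i hi) (zero_lt_one.trans hr)
    have hlt (i : ℕ) : ‖P.coeff i‖ < ‖P.coeff j * r‖ := by
      rw [norm_mul]
      exact (hle i).trans_lt (lt_mul_of_one_lt_right hpos hr)
    have htop : ‖(P * (X - C r)).coeff j‖ = ‖P.coeff j * r‖ := by
      cases j with
      | zero => rw [hzero, norm_neg]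
      | succ j =>
        have h := hlt j
        rw [← norm_neg (P.coeff (j + 1) * r)] at h ⊢
        rw [hsucc, IsUltrametricDist.norm_add_eq_max_of_norm_ne_norm h.ne, max_eq_right h.le]
    refine ⟨j, fun i hi => ?_⟩
    rw [htop]
    cases i with
    | zero => rw [hzero]; exact hbig 0 hi
    | succ i =>
      rw [hsucc]
      exact (IsUltrametricDist.norm_add_le_max _ _).trans_lt (max_lt (hlt i) (hbig _ hi))

/-- A polynomial over an algebraically closed non-archimedean field with at least two coefficients
of maximal norm has a root of norm one. -/
lemma exists_root_norm_eq_one [IsAlgClosed K] {P : K[X]} {i j : ℕ} (hij : i ≠ j)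
    (h : ‖P.coeff i‖ = ‖P.coeff j‖) (h0 : P.coeff j ≠ 0)
    (hmax : ∀ k, ‖P.coeff k‖ ≤ ‖P.coeff j‖) : ∃ r, P.eval r = 0 ∧ ‖r‖ = 1 := by
  by_contra! hno
  have hP : P ≠ 0 := by rintro rfl; simp at h0
  -- Building `P` from its linear factors, none with root of norm one, keeps a unique dominant
  -- coefficient, against the tie between `i` and `j`.
  have key (s : Multiset K) (hs : ∀ r ∈ s, ‖r‖ ≠ 1) :
      ∃ j, ∀ i, i ≠ j → ‖(C P.leadingCoeff * (s.map (X - C ·)).prod).coeff i‖ <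
        ‖(C P.leadingCoeff * (s.map (X - C ·)).prod).coeff j‖ := by
    induction s using Multiset.induction_on with
    | empty =>
      refine ⟨0, fun i hi => ?_⟩
      simp [coeff_C, hi, hP]
    | cons a s ih =>
      have h1 := exists_dominant_coeff_mul_X_sub_C (hs a (Multiset.mem_cons_self a s))
        (ih fun r hr => hs r (Multiset.mem_cons_of_mem hr))
      rwa [mul_assoc, mul_comm _ (X - C a), ← Multiset.prod_cons,
        ← Multiset.map_cons (fun x => X - C x)] at h1
  obtain ⟨m, hm⟩ := key P.roots fun r hr => hno r (isRoot_of_mem_roots hr)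
  rw [← (IsAlgClosed.splits P).eq_prod_roots] at hm
  by_cases hjm : j = m
  · subst hjm
    exact (hm i hij).ne h
  · exact absurd (hm j hjm) (not_lt.2 (hmax m))

end Dominant

/-! ### Evaluation of Laurent polynomials and reduction to one variable -/

section LaurentEval

variable {K : Type*} [Field K] {d : ℕ}

/-- Evaluation of Laurent polynomials at a point with nonzero coordinates. -/
def laurentHom (z : Fin d → Kˣ) : AddMonoidAlgebra ℤ (Fin d → ℤ) →ₐ[ℤ] K :=
  AddMonoidAlgebra.lift ℤ K (Fin d → ℤ)
    { toFun := fun ν => ∏ i, (z i : K) ^ (ν.toAdd i)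
      map_one' := by simp
      map_mul' := fun μ ν => by
        simp [zpow_add₀, Finset.prod_mul_distrib] }

lemma laurentHom_single (z : Fin d → Kˣ) (ν : Fin d → ℤ) (c : ℤ) :
    laurentHom z (AddMonoidAlgebra.single ν c) = c * ∏ i, (z i : K) ^ ν i := by
  simp [laurentHom]

lemma laurentHom_apply (z : Fin d → Kˣ) (f : AddMonoidAlgebra ℤ (Fin d → ℤ)) :
    laurentHom z f = laurentEval f fun i => (z i : K) := by
  rw [laurentHom, AddMonoidAlgebra.lift_apply, laurentEval, Finsupp.sum]
  simp

end LaurentEval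

/-- Distinct exponents give a nonzero polynomial in `b` as difference of weights; finitely many such
polynomials have a common non-root. The substitution `t_i = r ^ (b ^ i)` then keeps the monomials of
`s` apart. -/
lemma exists_injOn_weights {d : ℕ} (s : Finset (Fin d → ℤ)) :
    ∃ b : ℤ, Set.InjOn (fun ν : Fin d → ℤ => ∑ i : Fin d, b ^ (i : ℕ) * ν i) s := by
  classical
  let Q : (Fin d → ℤ) → Polynomial ℤ := fun δ => ∑ i : Fin d, Polynomial.C (δ i) * Polynomial.X ^ (i : ℕ)
  have hQ (δ : Fin d → ℤ) (hδ : δ ≠ 0) : Q δ ≠ 0 := by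
    intro h
    refine hδ (funext fun j => ?_)
    have := congrArg (fun P => Polynomial.coeff P (j : ℕ)) h
    simpa [Q, Polynomial.finsetSum_coeff, Polynomial.coeff_C_mul, Polynomial.coeff_X_pow,
      Fin.val_inj] using this
  have hprod : ∏ x ∈ s.offDiag, Q (x.1 - x.2) ≠ 0 :=
    Finset.prod_ne_zero_iff.2 fun x hx => hQ _ (sub_ne_zero.2 (Finset.mem_offDiag.1 hx).2.2)
  obtain ⟨b, hb⟩ : ∃ b : ℤ, (∏ x ∈ s.offDiag, Q (x.1 - x.2)).eval b ≠ 0 := by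
    by_contra! h
    exact hprod (Polynomial.funext fun b => by simpa using h b)
  rw [Polynomial.eval_prod, Finset.prod_ne_zero_iff] at hb
  refine ⟨b, fun μ hμ ν hν h => ?_⟩
  by_contra hne
  refine hb (μ, ν) (Finset.mem_offDiag.2 ⟨hμ, hν, hne⟩) ?_
  simp only [Q, Polynomial.eval_finsetSum, Polynomial.eval_mul, Polynomial.eval_C,
    Polynomial.eval_pow, Polynomial.eval_X, Pi.sub_apply, sub_mul, Finset.sum_sub_distrib]
  simp only [mul_comm] at h ⊢
  exact sub_eq_zero.2 h

/-! ### Shape of Laurent polynomials without zeros on the torus -/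

section Structure

variable {p : ℕ} [hp : Fact p.Prime] {d : ℕ}

lemma norm_intCast_eq_one_of_not_dvd {K : Type*} [NormedField K] [NormedAlgebra ℚ_[p] K] {c : ℤ}
    (hc : ¬ (p : ℤ) ∣ c) : ‖(c : K)‖ = 1 := by
  rw [← map_intCast (algebraMap ℚ_[p] K) c, norm_algebraMap']
  refine le_antisymm (Padic.norm_int_le_one c) (not_lt.1 fun h => hc ?_)
  exact (Padic.norm_intCast_lt_one_iff).1 h

/-- Two coefficients prime to `p` survive as coefficients of norm one in a one-variable
specialisation. A root `r` of norm one gives the zero `(r ^ (b ^ i))_i` on the torus. -/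
lemma eq_of_not_dvd_coeff {f : AddMonoidAlgebra ℤ (Fin d → ℤ)}
    (hf : ∀ z ∈ padicTorus p d, laurentEval f z ≠ 0) {μ ν : Fin d → ℤ}
    (hμ : ¬ (p : ℤ) ∣ f.coeff μ) (hν : ¬ (p : ℤ) ∣ f.coeff ν) : μ = ν := by
  by_contra hne
  obtain ⟨b, hb⟩ := exists_injOn_weights f.coeff.support
  set w : (Fin d → ℤ) → ℤ := fun ν => ∑ i : Fin d, b ^ (i : ℕ) * ν i with hw
  -- Weights can be negative; the factor `r ^ N` turns the specialisation into a polynomial.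
  obtain ⟨N, hN⟩ : ∃ N : ℕ, ∀ ν ∈ f.coeff.support, 0 ≤ w ν + N := by
    refine ⟨∑ ν ∈ f.coeff.support, (w ν).natAbs, fun ν hν => ?_⟩
    have := Finset.single_le_sum (f := fun ν => (w ν).natAbs) (fun _ _ => Nat.zero_le _) hν
    change (w ν).natAbs ≤ _ at this
    omega
  let e : (Fin d → ℤ) → ℕ := fun ν => (w ν + N).toNat
  have he : Set.InjOn e f.coeff.support := fun x hx y hy hxy => by
    refine hb hx hy ?_
    have h1 := hN x hx
    have h2 := hN y hy
    simp only [e] at hxy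
    change w x = w y
    omega
  let F : Polynomial ℤ := ∑ ν ∈ f.coeff.support, Polynomial.C (f.coeff ν) * Polynomial.X ^ e ν
  have hF (ν : Fin d → ℤ) (hν : ¬ (p : ℤ) ∣ f.coeff ν) : F.coeff (e ν) = f.coeff ν := by
    have hs : ν ∈ f.coeff.support := Finsupp.mem_support_iff.2 fun h => hν (h ▸ dvd_zero _)
    simp only [F, Polynomial.finsetSum_coeff, Polynomial.coeff_C_mul, Polynomial.coeff_X_pow]
    rw [Finset.sum_eq_single ν]
    · simp
    · intro x hx hxν
      rw [if_neg fun h => hxν (he hx hs h.symm), mul_zero]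
    · exact fun h => absurd hs h
  have hsupp {ν : Fin d → ℤ} (hν : ¬ (p : ℤ) ∣ f.coeff ν) : ν ∈ f.coeff.support :=
    Finsupp.mem_support_iff.2 fun h => hν (h ▸ dvd_zero _)
  have hnorm {ν : Fin d → ℤ} (hν : ¬ (p : ℤ) ∣ f.coeff ν) :
      ‖(F.map (Int.castRingHom ℂ_[p])).coeff (e ν)‖ = 1 := by
    rw [Polynomial.coeff_map, hF ν hν]
    exact norm_intCast_eq_one_of_not_dvd hν
  obtain ⟨r, hr, hr1⟩ := exists_root_norm_eq_one (K := ℂ_[p])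
    (P := F.map (Int.castRingHom ℂ_[p])) (i := e μ) (j := e ν)
    (fun h => hne (he (hsupp hμ) (hsupp hν) h)) ((hnorm hμ).trans (hnorm hν).symm)
    (norm_ne_zero_iff.1 (by rw [hnorm hν]; exact one_ne_zero)) (fun k => by
      rw [hnorm hν, Polynomial.coeff_map]
      change ‖((F.coeff k : ℤ) : ℂ_[p])‖ ≤ 1
      rw [← map_intCast (algebraMap ℚ_[p] ℂ_[p]), norm_algebraMap']
      exact Padic.norm_int_le_one _)
  have hr0 : r ≠ 0 := norm_ne_zero_iff.1 (by rw [hr1]; exact one_ne_zero)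
  refine hf (fun i => r ^ (b ^ (i : ℕ))) (fun i => by simp [hr1]) ?_
  have h1 : (F.map (Int.castRingHom ℂ_[p])).eval r =
      r ^ N * laurentEval f fun i => r ^ (b ^ (i : ℕ)) := by
    rw [laurentEval, Finset.mul_sum, Polynomial.eval_map]
    simp only [F, Polynomial.eval₂_finsetSum, Polynomial.eval₂_mul, Polynomial.eval₂_C,
      Polynomial.eval₂_pow, Polynomial.eval₂_X]
    refine Finset.sum_congr rfl fun x hx => ?_
    rw [eq_intCast]
    have h2 : ∏ i : Fin d, (r ^ (b ^ (i : ℕ))) ^ x i = r ^ w x := by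
      simp_rw [← zpow_mul, hw]
      generalize (Finset.univ : Finset (Fin d)) = s
      induction s using Finset.cons_induction with
      | empty => simp
      | cons a s ha ih => rw [Finset.prod_cons, Finset.sum_cons, zpow_add₀ hr0, ih]
    have h3 : r ^ e x = r ^ N * r ^ w x := by
      rw [← zpow_natCast, ← zpow_natCast, ← zpow_add₀ hr0, Int.toNat_of_nonneg (hN x hx), add_comm]
    rw [h2, h3]; ring
  rw [hr] at h1
  exact (mul_eq_zero.1 h1.symm).resolve_left (pow_ne_zero _ hr0)

lemma natCast_dvd_iff_coeff {Γ : Type*} [AddCommGroup Γ] {n : ℕ} {a : AddMonoidAlgebra ℤ Γ} :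
    (n : AddMonoidAlgebra ℤ Γ) ∣ a ↔ ∀ γ, (n : ℤ) ∣ a.coeff γ := by
  have hmul (b : AddMonoidAlgebra ℤ Γ) (γ : Γ) :
      ((n : AddMonoidAlgebra ℤ Γ) * b).coeff γ = n * b.coeff γ := by
    rw [← nsmul_eq_mul, ← nsmul_eq_mul]
    exact DFunLike.congr_fun (map_nsmul AddMonoidAlgebra.coeffAddEquiv n b) γ
  constructor
  · rintro ⟨b, rfl⟩ γ
    exact ⟨b.coeff γ, hmul b γ⟩
  · intro h
    refine ⟨.ofCoeff (a.coeff.mapRange (· / (n : ℤ)) (Int.zero_ediv _)), ?_⟩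
    ext γ
    rw [hmul]
    simp [Int.mul_ediv_cancel' (h γ)]

/-- A Laurent polynomial without zeros on the `p`-adic torus is the product of a power of `p`,
a monomial and a Laurent polynomial congruent to a unit constant modulo `p`. -/
lemma exists_eq_of_ne_zero_on_torus {f : AddMonoidAlgebra ℤ (Fin d → ℤ)}
    (hf : ∀ z ∈ padicTorus p d, laurentEval f z ≠ 0) :
    ∃ (k : ℕ) (ν : Fin d → ℤ) (c : ℤ) (g : AddMonoidAlgebra ℤ (Fin d → ℤ)), ¬ (p : ℤ) ∣ c ∧
      f = (p : AddMonoidAlgebra ℤ (Fin d → ℤ)) ^ k * AddMonoidAlgebra.single ν 1 *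
        ((c : AddMonoidAlgebra ℤ (Fin d → ℤ)) + (p : AddMonoidAlgebra ℤ (Fin d → ℤ)) * g) := by
  have hone : (fun _ => 1 : Fin d → ℂ_[p]) ∈ padicTorus p d := fun i => norm_one
  obtain ⟨γ, hγ⟩ : ∃ γ, f.coeff γ ≠ 0 := by
    by_contra! h
    exact hf _ hone (Finset.sum_eq_zero fun ν _ => by simp [h])
  have hfin : FiniteMultiplicity (p : AddMonoidAlgebra ℤ (Fin d → ℤ)) f := by
    obtain ⟨n, hn⟩ := Int.finiteMultiplicity_iff.2
      ⟨(by simpa using hp.out.ne_one : (p : ℤ).natAbs ≠ 1), hγ⟩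
    refine ⟨n, fun h => hn ?_⟩
    exact_mod_cast natCast_dvd_iff_coeff.1 (by exact_mod_cast h) γ
  obtain ⟨f₀, hf₀, hnd⟩ := hfin.exists_eq_pow_mul_and_not_dvd
  set k := multiplicity (p : AddMonoidAlgebra ℤ (Fin d → ℤ)) f
  rw [natCast_dvd_iff_coeff, not_forall] at hnd
  obtain ⟨ν, hν⟩ := hnd
  have hz : ∀ z ∈ padicTorus p d, laurentEval f₀ z ≠ 0 := by
    intro z hz h0
    have hz0 (i : Fin d) : z i ≠ 0 := norm_ne_zero_iff.1 (by rw [hz i]; exact one_ne_zero)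
    have h1 := laurentHom_apply (fun i => Units.mk0 (z i) (hz0 i)) f
    have h2 := laurentHom_apply (fun i => Units.mk0 (z i) (hz0 i)) f₀
    rw [hf₀, map_mul, h2] at h1
    simp only [Units.val_mk0] at h1
    rw [h0, mul_zero, ← hf₀] at h1
    exact hf z hz h1.symm
  have hdvd : (p : AddMonoidAlgebra ℤ (Fin d → ℤ)) ∣
      f₀ - AddMonoidAlgebra.single ν (f₀.coeff ν) := by
    rw [natCast_dvd_iff_coeff]
    intro γ
    by_cases h : ν = γ
    · subst h; simp
    · by_contra hnd
      refine h (eq_of_not_dvd_coeff hz hν (ν := γ) fun h' => hnd ?_)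
      simpa [Finsupp.single_apply, h] using h'
  obtain ⟨g, hg⟩ := hdvd
  refine ⟨k, ν, f₀.coeff ν, AddMonoidAlgebra.single (-ν) 1 * g, hν, ?_⟩
  have hinv : (AddMonoidAlgebra.single ν 1 * AddMonoidAlgebra.single (-ν) 1 :
      AddMonoidAlgebra ℤ (Fin d → ℤ)) = 1 := by
    rw [AddMonoidAlgebra.single_mul_single, add_neg_cancel, one_mul, AddMonoidAlgebra.one_def]
  have hc : (AddMonoidAlgebra.single ν (f₀.coeff ν) : AddMonoidAlgebra ℤ (Fin d → ℤ)) =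
      AddMonoidAlgebra.single ν 1 * ((f₀.coeff ν : ℤ) : AddMonoidAlgebra ℤ (Fin d → ℤ)) := by
    rw [mul_comm, ← zsmul_eq_mul, AddMonoidAlgebra.smul_single, smul_eq_mul, mul_one]
  rw [hc] at hg
  refine hf₀.trans ?_
  linear_combination (p : AddMonoidAlgebra ℤ (Fin d → ℤ)) ^ k * hg -
    (p : AddMonoidAlgebra ℤ (Fin d → ℤ)) ^ k * p * g * hinv

/-- Fermat's little theorem with `r = p - 1` makes the constant `c` congruent to `1` modulo `p`. The
extra factor `2` serves to remove the signs of determinants later. -/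
lemma exists_pow_eq_of_ne_zero_on_torus {f : AddMonoidAlgebra ℤ (Fin d → ℤ)}
    (hf : ∀ z ∈ padicTorus p d, laurentEval f z ≠ 0) :
    ∃ (r k : ℕ) (ν : Fin d → ℤ) (g : AddMonoidAlgebra ℤ (Fin d → ℤ)), 0 < r ∧
      f ^ (2 * r) = (p : AddMonoidAlgebra ℤ (Fin d → ℤ)) ^ k * AddMonoidAlgebra.single ν 1 ^ 2 *
        (1 + (p : AddMonoidAlgebra ℤ (Fin d → ℤ)) * g) := by
  obtain ⟨k, ν, c, g, hc, hfe⟩ := exists_eq_of_ne_zero_on_torus hf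
  have hr : 0 < p - 1 := Nat.sub_pos_of_lt hp.out.one_lt
  have hfermat : (p : ℤ) ∣ c ^ (p - 1) - 1 := by
    have hcop : IsCoprime c p :=
      ((Nat.prime_iff_prime_int.1 hp.out).coprime_iff_not_dvd.2 hc).symm
    exact (Int.ModEq.pow_card_sub_one_eq_one hp.out hcop).symm.dvd
  obtain ⟨e, he⟩ := hfermat.trans (sub_dvd_pow_sub_pow _ 1 2)
  obtain ⟨g', hg'⟩ := sub_dvd_pow_sub_pow
    ((c : AddMonoidAlgebra ℤ (Fin d → ℤ)) + (p : AddMonoidAlgebra ℤ (Fin d → ℤ)) * g) c (2 * (p - 1))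
  have he' := congrArg (Int.cast (R := AddMonoidAlgebra ℤ (Fin d → ℤ))) he
  push_cast [one_pow] at he'
  refine ⟨p - 1, k * (2 * (p - 1)), (p - 1) • ν, g * g' + e, hr, ?_⟩
  have hs : (AddMonoidAlgebra.single ((p - 1) • ν) 1 : AddMonoidAlgebra ℤ (Fin d → ℤ)) =
      AddMonoidAlgebra.single ν 1 ^ (p - 1) := by
    rw [AddMonoidAlgebra.single_pow, one_pow]
  rw [hfe, mul_pow, mul_pow, ← pow_mul, hs, ← pow_mul, mul_comm (p - 1) 2]
  congr 1
  rw [add_sub_cancel_left] at hg'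
  rw [← pow_mul, mul_comm (p - 1) 2] at he'
  linear_combination hg' + he'

end Structure

/-! ### Averages over roots of unity -/

section RootsOfUnity

variable {K : Type*} [Field K] {N : ℕ} {d : ℕ}

open Polynomial (nthRootsFinset)

lemma sum_nthRootsFinset_zpow {ω : K} (hN : 0 < N) (hω : IsPrimitiveRoot ω N) (a : ℤ) :
    ∑ ζ ∈ nthRootsFinset N (1 : K), ζ ^ a = if (N : ℤ) ∣ a then (N : K) else 0 := by
  split_ifs with h
  · obtain ⟨b, rfl⟩ := h
    rw [Finset.sum_congr rfl (g := fun _ => (1 : K)), Finset.sum_const, hω.card_nthRootsFinset,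
      nsmul_one]
    intro ζ hζ
    rw [Polynomial.mem_nthRootsFinset hN] at hζ
    rw [zpow_mul, zpow_natCast, hζ, one_zpow]
  · have hω0 : ω ≠ 0 := hω.ne_zero hN.ne'
    -- Multiplication by `ω` permutes the roots, and `ω ^ a ≠ 1`, so the sum must vanish.
    have h1 : ∑ ζ ∈ nthRootsFinset N (1 : K), ζ ^ a =
        ω ^ a * ∑ ζ ∈ nthRootsFinset N (1 : K), ζ ^ a := by
      rw [Finset.mul_sum]
      refine Finset.sum_bij' (fun ζ _ => ω⁻¹ * ζ) (fun ζ _ => ω * ζ) ?_ ?_ ?_ ?_ ?_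
      · intro ζ hζ
        rw [Polynomial.mem_nthRootsFinset hN] at hζ ⊢
        rw [mul_pow, inv_pow, hω.pow_eq_one, hζ, inv_one, one_mul]
      · intro ζ hζ
        rw [Polynomial.mem_nthRootsFinset hN] at hζ ⊢
        rw [mul_pow, hω.pow_eq_one, hζ, one_mul]
      · intro ζ _
        rw [mul_inv_cancel_left₀ hω0]
      · intro ζ _
        rw [inv_mul_cancel_left₀ hω0]
      · intro ζ _
        rw [← mul_zpow, mul_inv_cancel_left₀ hω0]
    have h2 : (1 - ω ^ a) * ∑ ζ ∈ nthRootsFinset N (1 : K), ζ ^ a = 0 := by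
      linear_combination h1
    refine (mul_eq_zero.1 h2).resolve_left fun h3 => h ?_
    exact (hω.zpow_eq_one_iff_dvd a).1 (sub_eq_zero.1 h3).symm

/-- The subgroup `N ℤ^d` of `ℤ^d`. -/
def multiplesSubgroup (d N : ℕ) : AddSubgroup (Fin d → ℤ) :=
  AddSubgroup.pi Set.univ fun _ => AddSubgroup.zmultiples (N : ℤ)

lemma mem_multiplesSubgroup {ν : Fin d → ℤ} :
    ν ∈ multiplesSubgroup d N ↔ ∀ i, (N : ℤ) ∣ ν i := by
  simp [multiplesSubgroup, AddSubgroup.mem_pi, Int.mem_zmultiples_iff]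

lemma eventually_notMem_multiplesSubgroup {ν : Fin d → ℤ} (hν : ν ≠ 0) :
    ∀ᶠ N in atTop, ν ∉ multiplesSubgroup d N := by
  obtain ⟨i, hi⟩ := Function.ne_iff.1 hν
  filter_upwards [eventually_gt_atTop (ν i).natAbs] with N hN h
  have h1 := Int.natAbs_dvd_natAbs.2 (mem_multiplesSubgroup.1 h i)
  have h2 := Nat.le_of_dvd (Int.natAbs_pos.2 hi) h1
  rw [Int.natAbs_natCast] at h2
  omega

/-- Averaging a Laurent polynomial over `μ_N^d` picks out the coefficients at `N ℤ^d`. -/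
lemma average_laurentEval [CharZero K] {ω : K} (hN : 0 < N) (hω : IsPrimitiveRoot ω N)
    (a : AddMonoidAlgebra ℤ (Fin d → ℤ)) :
    ((N : K) ^ d)⁻¹ * ∑ ζ ∈ Fintype.piFinset (fun _ : Fin d => nthRootsFinset N (1 : K)),
      laurentEval a ζ = (subgroupSum (multiplesSubgroup d N) a : K) := by
  classical
  have hN0 : (N : K) ≠ 0 := by exact_mod_cast hN.ne'
  have h (ν : Fin d → ℤ) :
      ∑ ζ ∈ Fintype.piFinset (fun _ : Fin d => nthRootsFinset N (1 : K)), ∏ i, ζ i ^ ν i =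
        if ν ∈ multiplesSubgroup d N then (N : K) ^ d else 0 := by
    rw [← Finset.prod_univ_sum (fun _ : Fin d => nthRootsFinset N (1 : K)) fun i ζ => ζ ^ ν i]
    simp_rw [sum_nthRootsFinset_zpow hN hω, mem_multiplesSubgroup]
    split_ifs with h
    · simp [h]
    · push Not at h
      obtain ⟨i, hi⟩ := h
      exact Finset.prod_eq_zero (Finset.mem_univ i) (if_neg hi)
  simp only [laurentEval]
  rw [Finset.sum_comm]
  simp_rw [← Finset.mul_sum, h]
  rw [subgroupSum_apply, Int.cast_sum, Finset.mul_sum]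
  refine Finset.sum_congr rfl fun ν _ => ?_
  split_ifs
  · field_simp
  · simp

end RootsOfUnity

/-! ### Both sides as limits of coefficient sums -/

section Main

variable {p : ℕ} [hp : Fact p.Prime]

lemma norm_laurentEval_le_one {d : ℕ} {z : Fin d → ℂ_[p]} (hz : z ∈ padicTorus p d)
    (a : AddMonoidAlgebra ℤ (Fin d → ℤ)) : ‖laurentEval a z‖ ≤ 1 := by
  refine IsUltrametricDist.norm_sum_le_of_forall_le_of_nonneg zero_le_one fun ν _ => ?_
  rw [norm_mul, norm_prod]
  simp only [norm_zpow, show ∀ i, ‖z i‖ = 1 from hz, one_zpow, Finset.prod_const_one, mul_one]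
  rw [← map_intCast (algebraMap ℚ_[p] ℂ_[p]), norm_algebraMap']
  exact Padic.norm_int_le_one _

lemma padicLog_card_fixedPoints {Γ : Type*} [AddCommGroup Γ] (H : AddSubgroup Γ)
    [H.FiniteIndex] {f u : AddMonoidAlgebra ℤ Γ} {l : ℕ → AddMonoidAlgebra ℤ Γ} {r k : ℕ} {ν : Γ}
    (hr : 0 < r)
    (hf : f ^ (2 * r) = (p : AddMonoidAlgebra ℤ Γ) ^ k * AddMonoidAlgebra.single ν 1 ^ 2 * u)
    (hu : ∀ n, u ^ p ^ n = 1 + (p : AddMonoidAlgebra ℤ Γ) ^ (n + 1) * l n) {t : ℚ_[p]}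
    (ht : Tendsto (fun n => (p : ℚ_[p]) * (subgroupSum H (l n) : ℚ_[p])) atTop (𝓝 t)) :
    (AddAction.fixedPoints H (subshift f)).Finite ∧
      (H.index : ℚ_[p])⁻¹ *
        padicLog p ((Nat.card (AddAction.fixedPoints H (subshift f)) : ℕ) : ℚ_[p]) =
      t / (2 * r : ℕ) := by
  classical
  have : Fintype (Γ ⧸ H) := Fintype.ofFinite _
  obtain ⟨h1, h2⟩ := tendsto_logSeries_det (p := p) H hu
  have hlog := tendsto_nhds_unique h2 (ht.const_mul (H.index : ℚ_[p]))
  have hp0 : (p : ℚ_[p]) ≠ 0 := by exact_mod_cast hp.out.ne_zero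
  have hdet : (quotientRep H f).det ^ (2 * r) =
      ((p : ℤ) ^ (Fintype.card (Γ ⧸ H))) ^ k * (quotientRep H u).det := by
    have hpm : ((p : ℕ) : Matrix (Γ ⧸ H) (Γ ⧸ H) ℤ).det = (p : ℤ) ^ (Fintype.card (Γ ⧸ H)) := by
      rw [← nsmul_one, ← natCast_zsmul, Matrix.det_smul, Matrix.det_one, mul_one]
    rw [← Matrix.det_pow, ← map_pow, hf, map_mul, map_mul, map_pow, map_pow, map_natCast,
      Matrix.det_mul, Matrix.det_mul, Matrix.det_pow, Matrix.det_pow, hpm,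
      det_quotientRep_single_sq, mul_one]
  have hu0 : (quotientRep H u).det ≠ 0 := by
    intro h
    rw [h] at h1
    simp at h1
  have hf0 : (quotientRep H f).det ≠ 0 := by
    intro h
    rw [h, zero_pow (by omega)] at hdet
    have hpz : (p : ℤ) ≠ 0 := by exact_mod_cast hp.out.ne_zero
    exact mul_ne_zero (pow_ne_zero _ (pow_ne_zero _ hpz)) hu0 hdet.symm
  obtain ⟨hfin, hcard⟩ := finite_card_fixedPoints H hf0
  refine ⟨hfin, ?_⟩
  -- The even exponent absorbs the absolute value, so `(2 r, k * (Γ : H))` is an admissible pair for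
  -- `padicLog_eq`.
  have habs : (((quotientRep H f).det.natAbs : ℕ) : ℚ_[p]) ^ (2 * r) *
      (p : ℚ_[p]) ^ (-((Fintype.card (Γ ⧸ H) * k : ℕ) : ℤ)) = ((quotientRep H u).det : ℚ_[p]) := by
    have h3 : (((quotientRep H f).det.natAbs : ℕ) : ℤ) ^ (2 * r) =
        (quotientRep H f).det ^ (2 * r) := by
      rw [pow_mul, pow_mul, Int.natAbs_sq]
    have h4 := congrArg (Int.cast (R := ℚ_[p])) (h3.trans hdet)
    rw [Int.cast_pow, Int.cast_natCast] at h4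
    rw [h4, zpow_neg, zpow_natCast, pow_mul]
    push_cast
    have := pow_ne_zero k (pow_ne_zero (Fintype.card (Γ ⧸ H)) hp0)
    field_simp
  have hidx : (H.index : ℚ_[p]) ≠ 0 := by exact_mod_cast AddSubgroup.FiniteIndex.index_ne_zero
  rw [hcard, padicLog_eq (by omega : 0 < 2 * r) (by rw [habs]; exact h1), habs, hlog]
  field_simp

lemma average_padicLog_laurentEval {d N : ℕ} (hN : 0 < N)
    {f u : AddMonoidAlgebra ℤ (Fin d → ℤ)} {l : ℕ → AddMonoidAlgebra ℤ (Fin d → ℤ)} {r k : ℕ}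
    {ν : Fin d → ℤ} (hr : 0 < r)
    (hf : f ^ (2 * r) =
      (p : AddMonoidAlgebra ℤ (Fin d → ℤ)) ^ k * AddMonoidAlgebra.single ν 1 ^ 2 * u)
    (hu : ∀ n, u ^ p ^ n = 1 + (p : AddMonoidAlgebra ℤ (Fin d → ℤ)) ^ (n + 1) * l n) {t : ℚ_[p]}
    (ht : Tendsto (fun n => (p : ℚ_[p]) * (subgroupSum (multiplesSubgroup d N) (l n) : ℚ_[p]))
      atTop (𝓝 t)) :
    ((N : ℂ_[p]) ^ d)⁻¹ * ∑ ζ ∈ Fintype.piFinset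
        (fun _ : Fin d => Polynomial.nthRootsFinset N (1 : ℂ_[p])),
      padicLog p (laurentEval f ζ) = algebraMap ℚ_[p] ℂ_[p] (t / (2 * r : ℕ)) := by
  have hp0 : (p : ℂ_[p]) ≠ 0 := by exact_mod_cast hp.out.ne_zero
  have hNe : NeZero (N : ℂ_[p]) := ⟨by exact_mod_cast hN.ne'⟩
  obtain ⟨ω, hω⟩ := HasEnoughRootsOfUnity.exists_primitiveRoot ℂ_[p] N
  have key : ∀ ζ ∈ Fintype.piFinset
      (fun _ : Fin d => Polynomial.nthRootsFinset N (1 : ℂ_[p])),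
      padicLog p (laurentEval f ζ) = logSeries (laurentEval u ζ) / (2 * r : ℕ) ∧
      Tendsto (fun n => (p : ℂ_[p]) * laurentEval (l n) ζ) atTop
        (𝓝 (logSeries (laurentEval u ζ))) := by
    intro ζ hζ
    have hζN (i : Fin d) : ζ i ^ N = 1 :=
      (Polynomial.mem_nthRootsFinset hN _).1 (Fintype.mem_piFinset.1 hζ i)
    have hζ1 : ζ ∈ padicTorus p d := fun i =>
      (pow_eq_one_iff_of_nonneg (norm_nonneg _) hN.ne').1 (by rw [← norm_pow, hζN, norm_one])
    have hζ0 (i : Fin d) : ζ i ≠ 0 := norm_ne_zero_iff.1 (by rw [hζ1 i]; exact one_ne_zero)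
    have hev (a : AddMonoidAlgebra ℤ (Fin d → ℤ)) :
        laurentEval a ζ = laurentHom (fun i => Units.mk0 (ζ i) (hζ0 i)) a :=
      (laurentHom_apply (fun i => Units.mk0 (ζ i) (hζ0 i)) a).symm
    have hpow (n : ℕ) : laurentEval u ζ ^ p ^ n =
        1 + (p : ℂ_[p]) ^ (n + 1) * laurentEval (l n) ζ := by
      rw [hev, hev, ← map_pow, hu, map_add, map_one, map_mul, map_pow, map_natCast]
    have hu1 : ‖laurentEval u ζ - 1‖ < 1 := by
      have h0 := hpow 0
      rw [pow_zero, pow_one, zero_add, pow_one] at h0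
      rw [h0, add_sub_cancel_left, norm_mul]
      exact mul_lt_one_of_nonneg_of_lt_one_left (norm_nonneg _) (norm_prime_cast_lt_one p ℂ_[p])
        (norm_laurentEval_le_one hζ1 _)
    refine ⟨?_, tendsto_logSeries_of_pow_eq hu1 hpow⟩
    have hmon : laurentHom (fun i => Units.mk0 (ζ i) (hζ0 i)) (AddMonoidAlgebra.single ν 1) ^ N =
        1 := by
      rw [laurentHom_single, Int.cast_one, one_mul, ← Finset.prod_pow]
      refine Finset.prod_eq_one fun i _ => ?_
      rw [Units.val_mk0, ← zpow_natCast, zpow_comm, zpow_natCast, hζN, one_zpow]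
    -- The monomial takes an `N`-th root of unity as value at `ζ`; a further `N`-th power kills it,
    -- at the price of a factor `N` that cancels in the logarithm.
    have hfN : laurentEval f ζ ^ (2 * r * N) * (p : ℂ_[p]) ^ (-((k * N : ℕ) : ℤ)) =
        laurentEval u ζ ^ N := by
      rw [pow_mul, hev f, ← map_pow, hf, map_mul, map_mul, map_pow, map_pow, map_natCast, ← hev u,
        mul_pow, mul_pow, ← pow_mul, pow_right_comm, hmon, one_pow, mul_one, zpow_neg, zpow_natCast]
      have := pow_ne_zero (k * N) hp0
      field_simp
    have hN0 : (N : ℂ_[p]) ≠ 0 := hNe.out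
    have hr0 : (r : ℂ_[p]) ≠ 0 := by exact_mod_cast hr.ne'
    rw [padicLog_eq (by positivity : 0 < 2 * r * N)
      (by rw [hfN]; exact norm_pow_sub_one_lt p hu1 N), hfN, logSeries_pow p hu1]
    push_cast
    field_simp
  rw [Finset.sum_congr rfl fun ζ hζ => (key ζ hζ).1, ← Finset.sum_div, ← mul_div_assoc, map_div₀,
    map_natCast]
  congr 1
  have h1 := (tendsto_finsetSum _ fun ζ hζ => (key ζ hζ).2).const_mul ((N : ℂ_[p]) ^ d)⁻¹
  have h2 := ((continuous_algebraMap ℚ_[p] ℂ_[p]).tendsto t).comp ht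
  refine tendsto_nhds_unique h1 (h2.congr fun n => ?_)
  rw [Function.comp_apply, ← Finset.mul_sum, mul_left_comm, average_laurentEval hN hω, map_mul,
    map_natCast, map_intCast]

end Main

end PadicEntropy

end

theorem theorem1p7 (p : ℕ) [Fact p.Prime] (d : ℕ) (f : AddMonoidAlgebra ℤ (Fin d → ℤ))
    (hf : ∀ z ∈ PadicEntropy.padicTorus p d, PadicEntropy.laurentEval f z ≠ 0) :
    ∃ h : ℚ_[p],
      (∀ Γs : ℕ → AddSubgroup (Fin d → ℤ), PadicEntropy.TendsToTrivial Γs →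
        PadicEntropy.HasPadicEntropy p (PadicEntropy.subshift f) Γs h) ∧
      PadicEntropy.HasPadicMahlerMeasure p f (algebraMap ℚ_[p] ℂ_[p] h) := by
  obtain ⟨r, k, ν, g, hr, hfr⟩ := PadicEntropy.exists_pow_eq_of_ne_zero_on_torus hf
  obtain ⟨l, hl⟩ := PadicEntropy.exists_pow_prime_pow_eq p g
  obtain ⟨T, hT, hlim⟩ := PadicEntropy.exists_tendsto_subgroupSum fun n => (hl n).2
  -- `T ⊥` is the constant coefficient of `log u`, where `u = 1 + p g`; the division undoes the
  -- power `2 r` of `f`.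
  refine ⟨T ⊥ / (2 * r : ℕ), fun Γs hΓ => ?_, ?_⟩
  · have key (n : ℕ) := by
      have := hΓ.finiteIndex n
      exact PadicEntropy.padicLog_card_fixedPoints (Γs n) hr hfr (fun n => (hl n).1) (hT (Γs n))
    refine ⟨fun n => (key n).1, ?_⟩
    refine Tendsto.congr (fun n => (key n).2.symm) (Tendsto.div_const (hlim fun γ hγ => ?_) _)
    rw [← Nat.cofinite_eq_atTop]
    simpa [Filter.eventually_cofinite] using hΓ.finite_mem γ hγ
  · have hle : atTop ⊓ 𝓟 {N : ℕ | N.Coprime p} ≤ atTop := inf_le_left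
    have h1 := hlim (F := atTop ⊓ 𝓟 {N : ℕ | N.Coprime p})
      (Hs := PadicEntropy.multiplesSubgroup d) fun γ hγ =>
        hle (PadicEntropy.eventually_notMem_multiplesSubgroup hγ)
    have h2 := ((continuous_algebraMap ℚ_[p] ℂ_[p]).tendsto _).comp
      (h1.div_const ((2 * r : ℕ) : ℚ_[p]))
    refine h2.congr' ?_
    filter_upwards [hle (eventually_gt_atTop 0)] with N hN
    exact (PadicEntropy.average_padicLog_laurentEval hN hr hfr (fun n => (hl n).1)
      (hT (PadicEntropy.multiplesSubgroup d N))).symm
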